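/- For $k>0$ let $\beta_{k,k}(dx)=\frac{\Gamma(2k)}{\Gamma(k)^2}\,x^{k-1}(1-x)^{k-1}\mathbf 1_{(0,1)}(x)\,dx$ be the symmetric beta law. A correlation matrix of order $n$ is a real symmetric positive semidefinite $n\times n$ matrix with all diagonal entries equal to $1$. A probability law $\mu$ on $\mathbb R$ is called $n$-universal if for every correlation matrix $R=(r_{ij})$ of order $n$ there is a random vector $(X_1,\dots,X_n)$ such that each $X_i$ has law $\mu$, the $X_i$ have finite second moment and nonzero variance, and $\operatorname{Cov}(X_i,X_j)/\sqrt{\operatorname{Var}(X_i)\operatorname{Var}(X_j)}=r_{ij}$ for all $i,j$. Theorem. For every real $k\ge 1/2$ the law $\beta_{k,k}$ is $3$-universal: every $3\times3$ correlation matrix is the correlation matrix of some random vector $(X,Y,Z)$ with $X,Y,Z\sim\beta_{k,k}$. In particular (case $k=1$), every $3\times 3$ correlation matrix is the correlation matrix of a three-dimensional copula, that is, of a random vector $(X,Y,Z)$ with $X,Y,Z$ uniformly distributed on $(0,1)$. -/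

import Mathlib

open MeasureTheory ProbabilityTheory

/-- The set of correlation matrices of order `n`: the real (symmetric) positive semidefinite
matrices whose diagonal entries are all equal to `1`. -/
def correlationMatrices (n : ℕ) : Set (Matrix (Fin n) (Fin n) ℝ) :=
  {R | R.PosSemidef ∧ ∀ i, R i i = 1}

/-- The Pearson correlation coefficient of two real random variables; it is meaningful when
both are square integrable with nonzero variance. -/
noncomputable def correlation {Ω : Type*} [MeasurableSpace Ω] (X Y : Ω → ℝ) (P : Measure Ω) : ℝ :=
  covariance X Y P / (√(variance X P) * √(variance Y P))

/-- `R` is the correlation matrix of the law `P` on `ℝⁿ`: every coordinate has a finite second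
moment and nonzero variance, and the `(i, j)` entry of `R` is the correlation of the `i`-th and
`j`-th coordinates. -/
structure HasCorrelationMatrix {n : ℕ} (P : Measure (Fin n → ℝ))
    (R : Matrix (Fin n) (Fin n) ℝ) : Prop where
  memLp : ∀ i, MemLp (fun x : Fin n → ℝ => x i) 2 P
  variance_ne_zero : ∀ i, variance (fun x : Fin n → ℝ => x i) P ≠ 0
  correlation_eq : ∀ i j, correlation (fun x : Fin n → ℝ => x i) (fun x => x j) P = R i j

/-- `P` is the law of a random vector `(X₁, …, Xₙ)` all of whose coordinates have law `μ`. -/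
structure HasIdenticalMarginals {n : ℕ} (P : Measure (Fin n → ℝ)) (μ : Measure ℝ) : Prop where
  isProbabilityMeasure : IsProbabilityMeasure P
  map_eval : ∀ i, P.map (fun x : Fin n → ℝ => x i) = μ

/-- A law `μ` on `ℝ` is `n`-universal if every correlation matrix of order `n` is the
correlation matrix of some random vector `(X₁, …, Xₙ)` with all marginals equal to `μ`. -/
def IsNUniversal (n : ℕ) (μ : Measure ℝ) : Prop :=
  ∀ R ∈ correlationMatrices n, ∃ P : Measure (Fin n → ℝ),
    HasIdenticalMarginals P μ ∧ HasCorrelationMatrix P R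

/-- An `n`-dimensional copula: the law of a random vector whose coordinates are all uniformly
distributed on `(0, 1)`. -/
def IsCopula {n : ℕ} (P : Measure (Fin n → ℝ)) : Prop :=
  HasIdenticalMarginals P (volume.restrict (Set.Ioo (0 : ℝ) 1))

/-! If a planar law is invariant under rotations, its projections onto the directions `θ i` all have
the same law, and their correlations are `cos (θ j - θ i)`. A symmetric beta law with `k ≥ 1/2` is,
up to the shift by `1/2`, such a projection: of a radial density on the disc of radius `1/2` when `k
> 1/2`, and of the uniform law on its boundary circle when `k = 1/2`. Hence every cosine matrix is
attained (`exists_marginals_covariance_cos`).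

In order three, fixing two entries `cos α`, `cos β` with `α, β ∈ [0, π]` confines the third to `[cos
(α + β), cos (α - β)]`, and both endpoints give cosine matrices. So every correlation matrix is a
convex combination of two of them (`exists_cos_decomposition`). Mixing laws with common marginals
mixes covariances with the same weights, because the means agree
(`HasIdenticalMarginals.covariance_mix`). -/

lemma HasIdenticalMarginals.memLp_eval {n : ℕ} {P : Measure (Fin n → ℝ)} {μ : Measure ℝ}
    (h : HasIdenticalMarginals P μ) (hμ : MemLp id 2 μ) (i : Fin n) :
    MemLp (fun x : Fin n → ℝ => x i) 2 P := by
  have := h.map_eval i ▸ hμ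
  exact this.comp_of_map (f := fun x : Fin n → ℝ => x i) (measurable_pi_apply i).aemeasurable

lemma HasIdenticalMarginals.integral_eval {n : ℕ} {P : Measure (Fin n → ℝ)} {μ : Measure ℝ}
    (h : HasIdenticalMarginals P μ) (i : Fin n) : ∫ x, x i ∂P = ∫ x, x ∂μ := by
  rw [← h.map_eval i, integral_map (measurable_pi_apply i).aemeasurable (by fun_prop)]

lemma HasIdenticalMarginals.variance_eval {n : ℕ} {P : Measure (Fin n → ℝ)} {μ : Measure ℝ}
    (h : HasIdenticalMarginals P μ) (i : Fin n) :
    variance (fun x : Fin n → ℝ => x i) P = variance id μ := by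
  conv_rhs => rw [← h.map_eval i]
  rw [variance_map (Y := fun x : Fin n → ℝ => x i) (by fun_prop)
      (measurable_pi_apply i).aemeasurable]
  rfl

/-- With identical nondegenerate square integrable marginals, it suffices to prescribe the
covariances. -/
lemma HasIdenticalMarginals.hasCorrelationMatrix {n : ℕ} {P : Measure (Fin n → ℝ)} {μ : Measure ℝ}
    {R : Matrix (Fin n) (Fin n) ℝ} (h : HasIdenticalMarginals P μ) (hμ : MemLp id 2 μ)
    (hv : variance id μ ≠ 0)
    (hcov : ∀ i j, covariance (fun x : Fin n → ℝ => x i) (fun x => x j) P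
      = R i j * variance id μ) : HasCorrelationMatrix P R where
  memLp := h.memLp_eval hμ
  variance_ne_zero i := by rwa [h.variance_eval]
  correlation_eq i j := by
    rw [correlation, hcov, h.variance_eval, h.variance_eval,
      Real.mul_self_sqrt (variance_nonneg _ _), mul_div_cancel_right₀ _ hv]

/-- Mixing two laws with the same marginals. -/
lemma HasIdenticalMarginals.mix {n : ℕ} {P Q : Measure (Fin n → ℝ)} {μ : Measure ℝ}
    (hP : HasIdenticalMarginals P μ) (hQ : HasIdenticalMarginals Q μ) {t : ℝ} (h0 : 0 ≤ t)
    (h1 : t ≤ 1) :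
    HasIdenticalMarginals (ENNReal.ofReal t • P + ENNReal.ofReal (1 - t) • Q) μ := by
  have hsum : ENNReal.ofReal t + ENNReal.ofReal (1 - t) = 1 := by
    rw [← ENNReal.ofReal_add h0 (by linarith)]; simp
  have := hP.isProbabilityMeasure
  have := hQ.isProbabilityMeasure
  refine ⟨⟨by simpa using hsum⟩, fun i => ?_⟩
  rw [Measure.map_add _ _ (by fun_prop), Measure.map_smul, Measure.map_smul, hP.map_eval,
    hQ.map_eval, ← add_smul, hsum, one_smul]

lemma HasIdenticalMarginals.covariance_mix {n : ℕ} {P Q : Measure (Fin n → ℝ)} {μ : Measure ℝ}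
    (hP : HasIdenticalMarginals P μ) (hQ : HasIdenticalMarginals Q μ) (hμ : MemLp id 2 μ) {t : ℝ}
    (h0 : 0 ≤ t) (h1 : t ≤ 1) (i j : Fin n) :
    covariance (fun x : Fin n → ℝ => x i) (fun x => x j)
        (ENNReal.ofReal t • P + ENNReal.ofReal (1 - t) • Q)
      = t * covariance (fun x : Fin n → ℝ => x i) (fun x => x j) P
        + (1 - t) * covariance (fun x : Fin n → ℝ => x i) (fun x => x j) Q := by
  have hM := hP.mix hQ h0 h1
  have := hP.isProbabilityMeasure
  have := hQ.isProbabilityMeasure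
  have := hM.isProbabilityMeasure
  rw [covariance_eq_sub (hM.memLp_eval hμ i) (hM.memLp_eval hμ j),
    covariance_eq_sub (hP.memLp_eval hμ i) (hP.memLp_eval hμ j),
    covariance_eq_sub (hQ.memLp_eval hμ i) (hQ.memLp_eval hμ j)]
  simp only [hM.integral_eval, hP.integral_eval, hQ.integral_eval]
  rw [integral_add_measure
    (((hP.memLp_eval hμ i).integrable_mul (hP.memLp_eval hμ j)).smul_measure (by simp))
    (((hQ.memLp_eval hμ i).integrable_mul (hQ.memLp_eval hμ j)).smul_measure (by simp)),
    integral_smul_measure, integral_smul_measure, ENNReal.toReal_ofReal h0,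
    ENNReal.toReal_ofReal (by linarith)]
  simp only [smul_eq_mul]
  ring

/-! ### Projections of rotation-invariant planar laws. -/

lemma Circle.re_exp_mul (x : ℝ) (z : ℂ) :
    ((Circle.exp x : ℂ) * z).re = Real.cos x * z.re - Real.sin x * z.im := by
  rw [Circle.coe_exp, Complex.mul_re, Complex.exp_ofReal_mul_I_re, Complex.exp_ofReal_mul_I_im]

lemma Circle.im_exp_mul (x : ℝ) (z : ℂ) :
    ((Circle.exp x : ℂ) * z).im = Real.cos x * z.im + Real.sin x * z.re := by
  rw [Circle.coe_exp, Complex.mul_im, Complex.exp_ofReal_mul_I_re, Complex.exp_ofReal_mul_I_im]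

/-- For a rotation-invariant law on the plane, the covariance of the real parts of `u z` and
`v z` is the cosine of the angle between `u` and `v`, times the variance of `Re z`. -/
lemma covariance_re_mul_of_rotation_invariant {ν : Measure ℂ} [IsProbabilityMeasure ν]
    (hrot : ∀ a : Circle, ν.map (fun z => (a : ℂ) * z) = ν)
    (hL : MemLp Complex.re 2 ν) (α β : ℝ) :
    covariance (fun z => ((Circle.exp α : ℂ) * z).re) (fun z => ((Circle.exp β : ℂ) * z).re) ν
      = Real.cos (β - α) * variance Complex.re ν := by
  have comp : ∀ (a : Circle) (f g : ℂ → ℝ), Continuous f → Continuous g →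
      covariance f g ν = covariance (fun z => f (a * z)) (fun z => g (a * z)) ν := by
    intro a f g hf hg
    conv_lhs => rw [← hrot a]
    rw [covariance_map_fun (by fun_prop) (by fun_prop) (by fun_prop)]
  have hLim : MemLp Complex.im 2 ν := by
    have h : MemLp Complex.re 2 (ν.map (fun z => ((Circle.exp (-(Real.pi / 2)) : Circle) : ℂ) * z)) := by
      rwa [hrot]
    convert h.comp_of_map (by fun_prop) using 1
    ext z
    simp
  -- A quarter turn sends `(re, im)` to `(-im, re)`, so this covariance equals its own negative.
  have hcross : covariance Complex.re Complex.im ν = 0 := by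
    have h := comp (Circle.exp (Real.pi / 2)) _ _ Complex.continuous_re Complex.continuous_im
    simp only [Circle.re_exp_mul, Circle.im_exp_mul, Real.cos_pi_div_two, Real.sin_pi_div_two,
      zero_mul, one_mul, zero_sub, zero_add] at h
    rw [covariance_fun_neg_left, covariance_comm Complex.im] at h
    linarith
  rw [comp (Circle.exp (-α)) _ _ (by fun_prop) (by fun_prop)]
  have e1 : (fun z : ℂ => ((Circle.exp α : ℂ) * ((Circle.exp (-α) : Circle) * z)).re)
      = Complex.re := by
    ext z
    rw [← mul_assoc, ← Circle.coe_mul, ← Circle.exp_add]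
    simp
  have e2 : (fun z : ℂ => ((Circle.exp β : ℂ) * ((Circle.exp (-α) : Circle) * z)).re)
      = (fun z => Real.cos (β - α) * z.re - Real.sin (β - α) * z.im) := by
    ext z
    rw [← mul_assoc, ← Circle.coe_mul, ← Circle.exp_add, ← sub_eq_add_neg]
    rw [Circle.re_exp_mul]
  rw [e1, e2, covariance_fun_sub_right hL (hL.const_mul _) (hLim.const_mul _),
    covariance_const_mul_right, covariance_const_mul_right, hcross, covariance_self (by fun_prop)]
  ring

/-- A law on the line which is a translate of the projection of a rotation-invariant law on the
plane realizes every cosine correlation matrix. -/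
lemma exists_marginals_covariance_cos {n : ℕ} {μ : Measure ℝ} [IsProbabilityMeasure μ]
    (hμ : MemLp id 2 μ) {ν : Measure ℂ} {m : ℝ}
    (hrot : ∀ a : Circle, ν.map (fun z => (a : ℂ) * z) = ν)
    (hmap : ν.map (fun z => m + z.re) = μ) (θ : Fin n → ℝ) :
    ∃ P : Measure (Fin n → ℝ), HasIdenticalMarginals P μ ∧
      ∀ i j, covariance (fun x : Fin n → ℝ => x i) (fun x => x j) P
        = Real.cos (θ j - θ i) * variance id μ := by
  have hν : IsProbabilityMeasure ν := by
    have : IsProbabilityMeasure (ν.map (fun z => m + z.re)) := by rwa [hmap]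
    exact Measure.isProbabilityMeasure_of_map (fun z : ℂ => m + z.re)
  have hLm : MemLp (fun z : ℂ => m + z.re) 2 ν :=
    (hmap.symm ▸ hμ : MemLp id 2 (ν.map (fun z => m + z.re))).comp_of_map (by fun_prop)
  have hL : MemLp Complex.re 2 ν := by
    convert hLm.sub (memLp_const m) using 1
    ext z; simp
  have hLa : ∀ a : Circle, MemLp (fun z : ℂ => ((a : ℂ) * z).re) 2 ν := fun a =>
    (by rwa [hrot a] : MemLp Complex.re 2 (ν.map (fun z => (a : ℂ) * z))).comp_of_map
      (by fun_prop)
  have hvar : variance Complex.re ν = variance id μ := by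
    rw [← hmap, variance_map (by fun_prop) (by fun_prop), ← covariance_self (by fun_prop),
      ← covariance_self (by fun_prop)]
    have hi : Integrable Complex.re ν := hL.integrable (by simp)
    have := covariance_const_add_left (Y := fun z : ℂ => m + z.re) hi m
    have h2 := covariance_const_add_right (X := Complex.re) hi m
    exact (this.trans h2).symm
  have hmeas : Measurable (fun (z : ℂ) (i : Fin n) => m + ((Circle.exp (θ i) : ℂ) * z).re) := by
    fun_prop
  refine ⟨ν.map (fun z i => m + ((Circle.exp (θ i) : ℂ) * z).re), ⟨?_, fun i => ?_⟩,
    fun i j => ?_⟩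
  · exact Measure.isProbabilityMeasure_map hmeas.aemeasurable
  · rw [Measure.map_map (by fun_prop) hmeas, ← hmap]
    conv_rhs => rw [← hrot (Circle.exp (θ i)), Measure.map_map (by fun_prop) (by fun_prop)]
    rfl
  · rw [covariance_map_fun (measurable_pi_apply i).aestronglyMeasurable
      (measurable_pi_apply j).aestronglyMeasurable hmeas.aemeasurable,
      covariance_const_add_left ((hLa _).integrable (by simp)),
      covariance_const_add_right ((hLa _).integrable (by simp)),
      covariance_re_mul_of_rotation_invariant hrot hL, hvar]

/-! ### Correlation matrices of order three. -/

/-- Every correlation matrix of order three is a convex combination of two cosine matrices. -/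
lemma exists_cos_decomposition {R : Matrix (Fin 3) (Fin 3) ℝ} (hR : R ∈ correlationMatrices 3) :
    ∃ (t : ℝ) (θ φ : Fin 3 → ℝ), 0 ≤ t ∧ t ≤ 1 ∧
      ∀ i j, R i j = t * Real.cos (θ j - θ i) + (1 - t) * Real.cos (φ j - φ i) := by
  obtain ⟨hpsd, hdiag⟩ := hR
  have hsymm : ∀ i j, R j i = R i j := fun i j => by simpa using hpsd.isHermitian.apply i j
  have h2 : ∀ i j, R i j ^ 2 ≤ 1 := by
    intro i j
    have := (hpsd.submatrix ![i, j]).det_nonneg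
    rw [Matrix.det_fin_two] at this
    simp [hdiag, hsymm i j] at this
    nlinarith
  have h3 := hpsd.det_nonneg
  rw [Matrix.det_fin_three] at h3
  simp only [hdiag, hsymm 0 1, hsymm 0 2, hsymm 1 2] at h3
  obtain ⟨ha0, ha1⟩ := abs_le.1 ((sq_le_one_iff_abs_le_one _).1 (h2 0 1))
  obtain ⟨hb0, hb1⟩ := abs_le.1 ((sq_le_one_iff_abs_le_one _).1 (h2 0 2))
  set a := R 0 1
  set b := R 0 2
  set c := R 1 2 with hc
  set s := √(1 - a ^ 2) * √(1 - b ^ 2) with hs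
  have hs0 : 0 ≤ s := by positivity
  have hs2 : s ^ 2 = (1 - a ^ 2) * (1 - b ^ 2) := by
    rw [hs, mul_pow, Real.sq_sqrt (by linarith [h2 0 1]), Real.sq_sqrt (by linarith [h2 0 2])]
  -- The determinant of `R` is `s ^ 2 - (c - a * b) ^ 2`.
  obtain ⟨hl, hu⟩ := abs_le.1 (abs_le_of_sq_le_sq (by nlinarith : (c - a * b) ^ 2 ≤ s ^ 2) hs0)
  obtain ⟨t, ht0, ht1, ht⟩ : ∃ t : ℝ, 0 ≤ t ∧ t ≤ 1 ∧ c = a * b + (2 * t - 1) * s := by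
    rcases hs0.eq_or_lt with h | h
    · exact ⟨0, le_rfl, zero_le_one, by rw [← h] at hl hu ⊢; linarith⟩
    · refine ⟨(c - a * b + s) / (2 * s), by apply div_nonneg <;> linarith,
        by rw [div_le_one (by linarith)]; linarith, by field_simp; ring⟩
  -- Flipping the sign of the last angle keeps `a` and `b` and changes the third cosine from `a * b
  -- + s` to `a * b - s`.
  refine ⟨t, ![0, Real.arccos a, Real.arccos b], ![0, Real.arccos a, -Real.arccos b], ht0, ht1, ?_⟩
  have key : t * Real.cos (Real.arccos b - Real.arccos a)
      + (1 - t) * Real.cos (-Real.arccos b - Real.arccos a) = c := by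
    rw [← neg_add', Real.cos_neg, Real.cos_sub, Real.cos_add, Real.cos_arccos ha0 ha1,
      Real.cos_arccos hb0 hb1, Real.sin_arccos, Real.sin_arccos, ht, hs]
    ring
  have key' : t * Real.cos (Real.arccos a - Real.arccos b)
      + (1 - t) * Real.cos (Real.arccos a + Real.arccos b) = c := by
    rw [← key, ← Real.cos_neg, neg_sub, ← Real.cos_neg (_ + _), neg_add, add_comm (-_),
      ← sub_eq_add_neg]
  intro i j
  fin_cases i <;> fin_cases j <;>
    simp [hdiag, hsymm 0 1, hsymm 0 2, hsymm 1 2, Real.cos_arccos, ha0, ha1, hb0, hb1, key, key'] <;> ring1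

theorem isNUniversal_three_of_rotation_invariant {μ : Measure ℝ} [IsProbabilityMeasure μ]
    (hμ : MemLp id 2 μ) (hv : variance id μ ≠ 0) {ν : Measure ℂ} {m : ℝ}
    (hrot : ∀ a : Circle, ν.map (fun z => (a : ℂ) * z) = ν)
    (hmap : ν.map (fun z => m + z.re) = μ) : IsNUniversal 3 μ := by
  intro R hR
  obtain ⟨t, θ, φ, h0, h1, h⟩ := exists_cos_decomposition hR
  obtain ⟨P, hP, hPc⟩ := exists_marginals_covariance_cos hμ hrot hmap θ
  obtain ⟨Q, hQ, hQc⟩ := exists_marginals_covariance_cos hμ hrot hmap φ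
  refine ⟨_, hP.mix hQ h0 h1, (hP.mix hQ h0 h1).hasCorrelationMatrix hμ hv fun i j => ?_⟩
  rw [hP.covariance_mix hQ hμ h0 h1, hPc, hQc, h]
  ring


/-! ### Radial densities projecting to the beta law, `k > 1/2`. -/

open scoped ENNReal

/-- The truncated power `t ↦ t₊ ^ p`, equal to `0` for `t ≤ 0`. -/
noncomputable def truncPow (p t : ℝ) : ℝ≥0∞ := if 0 < t then ENNReal.ofReal (t ^ p) else 0

@[fun_prop]
lemma measurable_truncPow (p : ℝ) : Measurable (truncPow p) :=
  Measurable.ite measurableSet_Ioi (by fun_prop) measurable_const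

lemma truncPow_mul {a : ℝ} (ha : 0 < a) (p t : ℝ) :
    truncPow p (a * t) = ENNReal.ofReal (a ^ p) * truncPow p t := by
  by_cases ht : 0 < t
  · rw [truncPow, truncPow, if_pos ht, if_pos (mul_pos ha ht), Real.mul_rpow ha.le ht.le,
      ENNReal.ofReal_mul (by positivity)]
  · rw [truncPow, truncPow, if_neg ht, if_neg (by rwa [mul_pos_iff_of_pos_left ha]), mul_zero]

lemma betaPDF_self_eq {k : ℝ} (hk : 0 < k) (x : ℝ) :
    betaPDF k k x
      = ENNReal.ofReal (1 / beta k k) * truncPow (k - 1) (1 / 4 - (x - 1 / 2) ^ 2) := by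
  have e : 1 / 4 - (x - 1 / 2) ^ 2 = x * (1 - x) := by ring
  have hB := beta_pos hk hk
  rw [e, betaPDF_eq, truncPow]
  by_cases hx : 0 < x ∧ x < 1
  · have h1 : 0 < 1 - x := by linarith [hx.2]
    rw [if_pos hx, if_pos (mul_pos hx.1 h1), Real.mul_rpow hx.1.le h1.le,
      ← ENNReal.ofReal_mul (by positivity), mul_assoc]
  · rw [if_neg hx, if_neg, ENNReal.ofReal_zero, mul_zero]
    intro h
    apply hx
    constructor <;> nlinarith

lemma lintegral_truncPow_mul_beta {k : ℝ} (hk : 0 < k) :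
    ENNReal.ofReal (1 / beta k k) * ∫⁻ v, truncPow (k - 1) (1 / 4 - v ^ 2) = 1 := by
  rw [← lintegral_const_mul _ (by fun_prop), ← lintegral_betaPDF_eq_one hk hk,
    ← lintegral_sub_right_eq_self _ (1 / 2 : ℝ)]
  simp only [betaPDF_self_eq hk]

/-- Substitute `y = √(4 * A) * v`: the Jacobian adds `1/2` to the exponent. This integrates a radial
density along vertical chords of the disc. -/
lemma lintegral_truncPow_sub_sq (p A : ℝ) :
    ∫⁻ y, truncPow p (A - y ^ 2) = ENNReal.ofReal (4 ^ (p + 1 / 2)) * truncPow (p + 1 / 2) A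
      * ∫⁻ v, truncPow p (1 / 4 - v ^ 2) := by
  by_cases hA : 0 < A
  · have hr : 0 < √(4 * A) := by positivity
    conv_lhs => rw [← Real.smul_map_volume_mul_left hr.ne']
    rw [lintegral_smul_measure, lintegral_map (by fun_prop) (by fun_prop)]
    have : ∀ v : ℝ, truncPow p (A - (√(4 * A) * v) ^ 2)
        = ENNReal.ofReal ((4 * A) ^ p) * truncPow p (1 / 4 - v ^ 2) := fun v => by
      rw [← truncPow_mul (by positivity), mul_pow, Real.sq_sqrt (by positivity)]
      congr 1
      ring
    simp only [this]
    rw [lintegral_const_mul _ (by fun_prop), smul_eq_mul, ← mul_assoc, truncPow, if_pos hA,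
      abs_of_pos hr, ← ENNReal.ofReal_mul hr.le, ← ENNReal.ofReal_mul (by positivity),
      ← Real.mul_rpow (by norm_num) hA.le, Real.sqrt_eq_rpow, ← Real.rpow_add (by positivity),
      add_comm]
  · have : ∀ y : ℝ, truncPow p (A - y ^ 2) = 0 := fun y => by
      rw [truncPow, if_neg]
      nlinarith [sq_nonneg y]
    simp only [this, lintegral_zero]
    rw [truncPow, if_neg hA, mul_zero, zero_mul]

lemma lintegral_betaMeasure_self {k : ℝ} (hk : 0 < k) {F : ℝ → ℝ≥0∞} (hF : Measurable F) :
    ∫⁻ x, F x ∂(betaMeasure k k) = ENNReal.ofReal (1 / beta k k)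
      * ∫⁻ x, truncPow (k - 1) (1 / 4 - x ^ 2) * F (1 / 2 + x) := by
  have hm : Measurable (betaPDF k k) := by
    simp only [funext (betaPDF_self_eq hk)]
    fun_prop
  rw [betaMeasure, lintegral_withDensity_eq_lintegral_mul _ hm hF,
    ← lintegral_const_mul _ (by fun_prop), ← lintegral_add_left_eq_self _ (1 / 2 : ℝ)]
  refine lintegral_congr fun x => ?_
  rw [Pi.mul_apply, betaPDF_self_eq hk, mul_assoc, add_sub_cancel_left]

/-- For `1 / 2 < k`, the symmetric beta law is a translate of a projection of a rotation-invariant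
law with density `(1 / 4 - |z| ^ 2)₊ ^ (k - 3 / 2)` up to normalization. -/
lemma exists_rotation_invariant_betaMeasure_of_lt {k : ℝ} (hk : 1 / 2 < k) :
    ∃ ν : Measure ℂ, (∀ a : Circle, ν.map (fun z => (a : ℂ) * z) = ν) ∧
      ν.map (fun z => 1 / 2 + z.re) = betaMeasure k k := by
  set D : ℂ → ℝ≥0∞ := fun z => truncPow (k - 3 / 2) (1 / 4 - Complex.normSq z) with hD
  have hDm : Measurable D :=
    (measurable_truncPow _).comp (measurable_const.sub Complex.continuous_normSq.measurable)
  set c := ∫⁻ v : ℝ, truncPow (k - 3 / 2) (1 / 4 - v ^ 2) with hc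
  -- Up to normalization `c` is the total mass of the beta law of parameter `k - 1/2`, which is
  -- positive by `hk`; hence `c` is finite and nonzero.
  have hc1 : ENNReal.ofReal (1 / beta (k - 1 / 2) (k - 1 / 2)) * c = 1 := by
    have := lintegral_truncPow_mul_beta (k := k - 1 / 2) (by linarith)
    rwa [show k - 1 / 2 - 1 = k - 3 / 2 by ring] at this
  have hc0 : c ≠ 0 := by rintro h; simp [h] at hc1
  have hct : c ≠ ∞ := by
    intro h
    rw [h] at hc1
    by_cases h0 : ENNReal.ofReal (1 / beta (k - 1 / 2) (k - 1 / 2)) = 0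
    · rw [h0] at hc1; simp at hc1
    · rw [ENNReal.mul_top h0] at hc1; simp at hc1
  set K := ENNReal.ofReal (4 ^ (k - 1)) * c with hK
  have hK0 : K ≠ 0 := mul_ne_zero (by simpa using by positivity) hc0
  have hKt : K ≠ ∞ := ENNReal.mul_ne_top ENNReal.ofReal_ne_top hct
  have hmarg : ∀ F : ℝ → ℝ≥0∞, Measurable F → ∫⁻ z, F (1 / 2 + z.re) ∂(volume.withDensity D)
      = K * ∫⁻ x, truncPow (k - 1) (1 / 4 - x ^ 2) * F (1 / 2 + x) := by
    intro F hF
    rw [lintegral_withDensity_eq_lintegral_mul _ hDm (by fun_prop),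
      ← Complex.volume_preserving_equiv_real_prod.symm.lintegral_comp (by fun_prop),
      Measure.volume_eq_prod, lintegral_prod _ (by fun_prop),
      ← lintegral_const_mul _ (by fun_prop)]
    refine lintegral_congr fun x => ?_
    have : ∀ y : ℝ, (D * fun z : ℂ => F (1 / 2 + z.re))
        (Complex.measurableEquivRealProd.symm (x, y))
        = truncPow (k - 3 / 2) (1 / 4 - x ^ 2 - y ^ 2) * F (1 / 2 + x) := fun y => by
      rw [Pi.mul_apply, hD, Complex.measurableEquivRealProd_symm_apply]
      simp only [Complex.normSq_mk]
      congr 2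
      ring
    simp only [this]
    rw [lintegral_mul_const _ (by fun_prop), lintegral_truncPow_sub_sq,
      show k - 3 / 2 + 1 / 2 = k - 1 by ring, hK]
    ring
  have hrot : ∀ a : Circle, (volume.withDensity D).map (fun z => (a : ℂ) * z)
      = volume.withDensity D := by
    intro a
    refine Measure.ext_of_lintegral _ fun F hF => ?_
    rw [lintegral_map hF (by fun_prop),
      lintegral_withDensity_eq_lintegral_mul _ hDm (by fun_prop),
      lintegral_withDensity_eq_lintegral_mul _ hDm hF]
    conv_rhs => rw [← (rotation a).measurePreserving.lintegral_comp (by fun_prop)]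
    refine lintegral_congr fun z => ?_
    simp [hD, rotation_apply]
  refine ⟨(ENNReal.ofReal (1 / beta k k) * K⁻¹) • volume.withDensity D, fun a => ?_, ?_⟩
  · rw [Measure.map_smul, hrot]
  · refine Measure.ext_of_lintegral _ fun F hF => ?_
    rw [lintegral_map hF (by fun_prop), lintegral_smul_measure, hmarg F hF,
      lintegral_betaMeasure_self (by linarith) hF, smul_eq_mul, mul_assoc, ← mul_assoc K⁻¹,
      ENNReal.inv_mul_cancel hK0 hKt, one_mul]

/-! ### The arcsine law, `k = 1/2`. -/

lemma image_half_add_cos_div_two :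
    (fun t => 1 / 2 + Real.cos t / 2) '' Set.Ioo 0 Real.pi = Set.Ioo (0 : ℝ) 1 := by
  ext x
  constructor
  · rintro ⟨t, ht, rfl⟩
    have h := Real.sin_pos_of_mem_Ioo ht
    have h2 := Real.sin_sq_add_cos_sq t
    constructor <;> simp only <;> nlinarith
  · intro hx
    refine ⟨Real.arccos (2 * x - 1), ⟨Real.arccos_pos.2 (by linarith [hx.2]), ?_⟩, ?_⟩
    · exact lt_of_le_of_ne (Real.arccos_le_pi _) fun h => by
        rw [Real.arccos_eq_pi] at h
        linarith [hx.1]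
    · simp only
      rw [Real.cos_arccos (by linarith [hx.1]) (by linarith [hx.2])]
      ring

/-- The arcsine law is the law of `1 / 2 + cos t / 2`, up to normalization. -/
lemma lintegral_betaMeasure_one_half {F : ℝ → ℝ≥0∞} (hF : Measurable F) :
    ∫⁻ x, F x ∂(betaMeasure (1 / 2) (1 / 2)) = ENNReal.ofReal (1 / beta (1 / 2) (1 / 2))
      * ∫⁻ t in Set.Ioo 0 Real.pi, F (1 / 2 + Real.cos t / 2) := by
  have hm : Measurable (betaPDF (1 / 2) (1 / 2)) := by
    simp only [funext (betaPDF_self_eq (by norm_num : (0 : ℝ) < 1 / 2))]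
    fun_prop
  have hsupp : ∫⁻ x, (betaPDF (1 / 2) (1 / 2) * F) x
      = ∫⁻ x in Set.Ioo 0 1, (betaPDF (1 / 2) (1 / 2) * F) x := by
    rw [← lintegral_indicator measurableSet_Ioo]
    refine lintegral_congr fun x => ?_
    by_cases hx : x ∈ Set.Ioo (0 : ℝ) 1
    · rw [Set.indicator_of_mem hx]
    · rw [Set.indicator_of_notMem hx, Pi.mul_apply, betaPDF_eq, if_neg (by exact hx)]
      simp
  rw [betaMeasure, lintegral_withDensity_eq_lintegral_mul _ hm hF, hsupp,
    ← image_half_add_cos_div_two,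
    lintegral_image_eq_lintegral_abs_deriv_mul (f' := fun t => -Real.sin t / 2) measurableSet_Ioo,
    ← lintegral_const_mul _ (by fun_prop)]
  · refine setLIntegral_congr_fun measurableSet_Ioo fun t ht => ?_
    have h := Real.sin_pos_of_mem_Ioo ht
    have e : 1 / 4 - (1 / 2 + Real.cos t / 2 - 1 / 2) ^ 2 = (Real.sin t / 2) ^ 2 := by
      linear_combination (-1 / 4) * Real.sin_sq_add_cos_sq t
    simp only [Pi.mul_apply]
    -- The density contributes `((sin t / 2) ^ 2) ^ (-1/2)`, which cancels the Jacobian `sin t / 2`.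
    rw [betaPDF_self_eq (by norm_num), e, truncPow, if_pos (by positivity),
      ← Real.rpow_natCast_mul (by positivity), ← mul_assoc, mul_left_comm, neg_div, abs_neg,
      abs_of_pos (by positivity), ← ENNReal.ofReal_mul (by positivity)]
    norm_num
    rw [Real.rpow_neg_one, mul_inv_cancel₀ (by positivity)]
    simp
  · intro t _
    have := ((Real.hasDerivAt_cos t).div_const 2).const_add (1 / 2)
    exact this.hasDerivWithinAt
  · intro s hs t ht h
    exact Real.injOn_cos (Set.Ioo_subset_Icc_self hs) (Set.Ioo_subset_Icc_self ht)
      (by simp only at h; linarith)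

/-- The witness is the normalized arc length on the circle of radius `1/2`; the upper and lower half
circles have the same projection, whence the factor `2⁻¹`. -/
lemma exists_rotation_invariant_betaMeasure_one_half :
    ∃ ν : Measure ℂ, (∀ a : Circle, ν.map (fun z => (a : ℂ) * z) = ν) ∧
      ν.map (fun z => 1 / 2 + z.re) = betaMeasure (1 / 2) (1 / 2) := by
  have : Fact (0 < 2 * Real.pi) := ⟨by positivity⟩
  set E : AddCircle (2 * Real.pi) → ℂ := fun t => (AddCircle.toCircle t : ℂ) / 2 with hE
  have hEm : Measurable E := by
    have := AddCircle.continuous_toCircle (T := 2 * Real.pi)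
    exact Continuous.measurable (by fun_prop)
  have hrot : ∀ a : Circle, ((volume : Measure (AddCircle (2 * Real.pi))).map E).map
      (fun z => (a : ℂ) * z) = (volume : Measure (AddCircle (2 * Real.pi))).map E := by
    intro a
    obtain ⟨s, hs⟩ : ∃ s : AddCircle (2 * Real.pi), s.toCircle = a :=
      ⟨(Complex.arg a : ℝ), by simp [AddCircle.toCircle_apply_mk, Circle.exp_arg]⟩
    rw [Measure.map_map (by fun_prop) hEm]
    conv_rhs => rw [← (measurePreserving_add_left volume s).map_eq,
      Measure.map_map hEm (by fun_prop)]
    congr 1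
    ext t
    simp [hE, AddCircle.toCircle_add, hs, mul_div_assoc]
  have hmarg : ∀ F : ℝ → ℝ≥0∞, Measurable F →
      ∫⁻ z, F (1 / 2 + z.re) ∂((volume : Measure (AddCircle (2 * Real.pi))).map E)
      = 2 * ∫⁻ t in Set.Ioo 0 Real.pi, F (1 / 2 + Real.cos t / 2) := by
    intro F hF
    rw [lintegral_map (by fun_prop) hEm,
      ← (AddCircle.measurePreserving_mk (2 * Real.pi) (-Real.pi)).lintegral_comp (by fun_prop)]
    have e : ∀ t : ℝ, F (1 / 2 + (E t).re) = F (1 / 2 + Real.cos t / 2) := fun t => by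
      simp [hE, AddCircle.toCircle_apply_mk, Circle.coe_exp, Complex.exp_ofReal_mul_I_re,
        Real.pi_ne_zero]
    simp only [e]
    have hneg : ∫⁻ t in Set.Ioo (-Real.pi) 0, F (1 / 2 + Real.cos t / 2)
        = ∫⁻ t in Set.Ioo 0 Real.pi, F (1 / 2 + Real.cos t / 2) := by
      rw [← (Measure.measurePreserving_neg (volume : Measure ℝ)).setLIntegral_comp_preimage
        measurableSet_Ioo (by fun_prop)]
      simp
    rw [show -Real.pi + 2 * Real.pi = Real.pi by ring,
      ← Set.Ioc_union_Ioc_eq_Ioc (neg_nonpos.2 Real.pi_pos.le) Real.pi_pos.le,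
      lintegral_union measurableSet_Ioc (Set.Ioc_disjoint_Ioc_of_le le_rfl),
      setLIntegral_congr Ioo_ae_eq_Ioc.symm, setLIntegral_congr Ioo_ae_eq_Ioc.symm, hneg, two_mul]
  refine ⟨(ENNReal.ofReal (1 / beta (1 / 2) (1 / 2)) * 2⁻¹) •
    (volume : Measure (AddCircle (2 * Real.pi))).map E, fun a => ?_, ?_⟩
  · rw [Measure.map_smul, hrot]
  · refine Measure.ext_of_lintegral _ fun F hF => ?_
    rw [lintegral_map hF (by fun_prop), lintegral_smul_measure, hmarg F hF,
      lintegral_betaMeasure_one_half hF, smul_eq_mul, mul_assoc, ← mul_assoc 2⁻¹,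
      ENNReal.inv_mul_cancel (by simp) (by simp), one_mul]

/-! ### Moments of beta laws and conclusion. -/

lemma memLp_id_betaMeasure {α β : ℝ} (hα : 0 < α) (hβ : 0 < β) :
    MemLp id 2 (betaMeasure α β) := by
  have := isProbabilityMeasureBeta hα hβ
  refine MemLp.of_bound (by fun_prop) 1 ?_
  have hm : Measurable (betaPDF α β) := (measurable_betaPDFReal α β).ennreal_ofReal
  rw [betaMeasure, ae_withDensity_iff hm]
  refine Filter.Eventually.of_forall fun x hx => ?_
  have h0 : 0 < x := by by_contra h; exact hx (betaPDF_eq_zero_of_nonpos (not_lt.1 h))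
  have h1 : x < 1 := by by_contra h; exact hx (betaPDF_eq_zero_of_one_le (not_lt.1 h))
  rw [id, Real.norm_of_nonneg h0.le]
  exact h1.le

/-- Zero variance would concentrate the law at its mean, but a law with a density has no atoms. -/
lemma variance_id_betaMeasure_ne_zero {α β : ℝ} (hα : 0 < α) (hβ : 0 < β) :
    variance id (betaMeasure α β) ≠ 0 := by
  have := isProbabilityMeasureBeta hα hβ
  intro h
  have hae := ae_eq_integral_of_variance_eq_zero (memLp_id_betaMeasure hα hβ) h
  have hna : ∀ᵐ x ∂(betaMeasure α β), x ≠ ∫ y, id y ∂(betaMeasure α β) :=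
    (withDensity_absolutelyContinuous _ _).ae_le (Measure.ae_ne volume _)
  obtain ⟨x, h1, h2⟩ := (hae.and hna).exists
  exact h2 h1

lemma betaMeasure_one_one : betaMeasure 1 1 = volume.restrict (Set.Ioo (0 : ℝ) 1) := by
  rw [betaMeasure, ← withDensity_indicator_one measurableSet_Ioo]
  congr 1
  ext x
  by_cases hx : x ∈ Set.Ioo (0 : ℝ) 1
  · rw [Set.indicator_of_mem hx, betaPDF_of_pos_lt_one hx.1 hx.2]
    simp [beta, one_add_one_eq_two]
  · rw [Set.indicator_of_notMem hx, betaPDF_eq, if_neg (by exact hx), ENNReal.ofReal_zero]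

/-- The symmetric beta laws of parameter at least `1 / 2` are `3`-universal. -/
theorem isNUniversal_three_betaMeasure {k : ℝ} (hk : 1 / 2 ≤ k) :
    IsNUniversal 3 (betaMeasure k k) := by
  have hk0 : 0 < k := by linarith
  have := isProbabilityMeasureBeta hk0 hk0
  obtain ⟨ν, hrot, hmap⟩ : ∃ ν : Measure ℂ,
      (∀ a : Circle, ν.map (fun z => (a : ℂ) * z) = ν) ∧
        ν.map (fun z => 1 / 2 + z.re) = betaMeasure k k := by
    rcases hk.eq_or_lt with rfl | h
    · exact exists_rotation_invariant_betaMeasure_one_half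
    · exact exists_rotation_invariant_betaMeasure_of_lt h
  exact isNUniversal_three_of_rotation_invariant (memLp_id_betaMeasure hk0 hk0)
    (variance_id_betaMeasure_ne_zero hk0 hk0) hrot hmap

theorem mainTheorem1 :
    (∀ k : ℝ, 1 / 2 ≤ k → IsNUniversal 3 (betaMeasure k k)) ∧
      (∀ R ∈ correlationMatrices 3, ∃ P : Measure (Fin 3 → ℝ),
        IsCopula P ∧ HasCorrelationMatrix P R) := by
  refine ⟨fun k hk => isNUniversal_three_betaMeasure hk, fun R hR => ?_⟩
  have h := isNUniversal_three_betaMeasure (k := 1) (by norm_num) R hR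
  rwa [betaMeasure_one_one] at h
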